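/- Let $m\ge 1$ and $n\ge 0$ be integers and let $\alpha>1$. Let $L_k^{(\beta)}(x)=\sum_{i=0}^k(-1)^i\binom{k+\beta}{k-i}\frac{x^i}{i!}$ be the Laguerre polynomials ($L_{-1}^{(\beta)}:=0$), put $S(x)=L_m^{(\alpha-1)}(-x)$, and let $$L^{I,(\alpha)}_{m,m+n}(x)=L_m^{(\alpha)}(-x)\,L_n^{(\alpha-1)}(x)+L_m^{(\alpha-1)}(-x)\,L_{n-1}^{(\alpha)}(x)$$ be the exceptional ($X_m$-)Laguerre polynomials of the first kind. Let $P_{m,n}(x)=\frac1{m!}\prod_z(x-z)$, the product being over the negative zeros $z$ of $L^{I,(\alpha)}_{m,m+n}$, counted with multiplicity, and let $$v(x)=v^{(\alpha+1)}_{m,n}(x)=\frac{x^{\alpha+1}e^{-x}P_{m,n}(x)^2}{S(x)^2},\qquad x>0.$$ Given a function $w$ on $(0,\infty)$ that is positive there, a system of polynomials $\hat l_1,\dots,\hat l_n$ (of arbitrary degrees) is called a $w$-stable interpolatory system on $(0,\infty)$ with nodes $x_1,\dots,x_n\in(0,\infty)$ if $\hat l_k(x_i)=\delta_{ki}$ for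 all $i,k$ and, for all $y_1,\dots,y_n\ge 0$ and all $x\in(0,\infty)$, $$0\le w(x)\sum_{k=1}^n\frac{\hat l_k(x)}{w(x_k)}\,y_k\le\max_k y_k$$ (for $n=0$ the maximum is read as $0$). Such a system is called most economical if $\sum_{k=1}^n\deg\hat l_k$ is minimal among all $w$-stable interpolatory systems of $n$ polynomials on $(0,\infty)$, for all choices of the nodes in $(0,\infty)$. Theorem 3. The polynomial $L^{I,(\alpha)}_{m,m+n}$ has exactly $n$ distinct positive zeros $x_1<\dots<x_n$, the weight $v$ is positive on $(0,\infty)$, and, with the fundamental polynomials of Lagrange interpolation $l_k(x)=\prod_{j\ne k}\frac{x-x_j}{x_k-x_j}$, the system $l_1^2,\dots,l_n^2$ of the Grünwald operator on these zeros is a $v$-stable interpolatory system on $(0,\infty)$ with nodes $x_1,\dots,x_n$. Moreover it is most economical. -/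

import Mathlib

open Polynomial

noncomputable section

/-- The generalized Laguerre polynomial
`L_k^{(α)}(x) = ∑_{i=0}^{k} (-1)^i * binom(k + α, k - i) * x^i / i!`, where
`binom(k + α, k - i) = (α + i + 1)(α + i + 2) ⋯ (α + k) / (k - i)!`. -/
def laguerre (k : ℕ) (α : ℝ) : ℝ[X] :=
  ∑ i ∈ Finset.range (k + 1),
    C ((-1) ^ i * ((ascPochhammer ℝ (k - i)).eval (α + i + 1) / (k - i).factorial)
      / i.factorial) * X ^ i

/-- The polynomial `S(x) = L_m^{(α-1)}(-x)`. -/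
def laguerreS (m : ℕ) (α : ℝ) : ℝ[X] := (laguerre m (α - 1)).comp (-X)

/-- The exceptional (`X_m`-) Laguerre polynomial of the first kind
`L^{I,(α)}_{m,m+n}(x) = L_m^{(α)}(-x) L_n^{(α-1)}(x) + L_m^{(α-1)}(-x) L_{n-1}^{(α)}(x)`,
with `L_{-1} = 0`. It has degree `m + n`. -/
def exceptionalLaguerreI (m n : ℕ) (α : ℝ) : ℝ[X] :=
  (laguerre m α).comp (-X) * laguerre n (α - 1)
    + laguerreS m α * (match n with
        | 0 => 0
        | k + 1 => laguerre k α)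

/-- `P_{m,n}(x) = (1 / m!) ∏ (x - z)`, the product over the negative (exceptional) zeros `z`
of `L^{I,(α)}_{m,m+n}`. -/
def exceptionalFactor (m n : ℕ) (α : ℝ) : ℝ[X] :=
  C (1 / (m.factorial : ℝ)) *
    (((exceptionalLaguerreI m n α).roots.filter (fun z => z < 0)).map (fun z => X - C z)).prod

/-- The weight `v^{(α+1)}_{m,n}(x) = x^{α+1} e^{-x} P_{m,n}(x)^2 / S(x)^2` on `(0, ∞)`. -/
def vWeight (m n : ℕ) (α : ℝ) (x : ℝ) : ℝ :=
  x ^ (α + 1) * Real.exp (-x) * (exceptionalFactor m n α).eval x ^ 2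
    / (laguerreS m α).eval x ^ 2

/-- The polynomials `l 1, …, l n` form an interpolatory system on the nodes `x 1, …, x n`. -/
def IsInterpolatory {n : ℕ} (x : Fin n → ℝ) (l : Fin n → ℝ[X]) : Prop :=
  ∀ k i, (l k).eval (x i) = if k = i then 1 else 0

/-- `l` is a `w`-stable interpolatory system on `I` with nodes `x k ∈ I`, where `w` is a
positive weight on `I`. The supremum over `Fin n` is the maximum (and is `0` if `n = 0`). -/
structure IsStable {n : ℕ} (w : ℝ → ℝ) (I : Set ℝ) (x : Fin n → ℝ) (l : Fin n → ℝ[X]) :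
    Prop where
  weight_pos : ∀ t ∈ I, 0 < w t
  nodes_mem : ∀ k, x k ∈ I
  interpolatory : IsInterpolatory x l
  nonneg : ∀ y : Fin n → ℝ, (∀ k, 0 ≤ y k) → ∀ t ∈ I,
    0 ≤ w t * ∑ k, (l k).eval t / w (x k) * y k
  le_max : ∀ y : Fin n → ℝ, (∀ k, 0 ≤ y k) → ∀ t ∈ I,
    w t * ∑ k, (l k).eval t / w (x k) * y k ≤ ⨆ k, y k

/-- A `w`-stable interpolatory system on `I` is most economical if its total degree is minimal
among all `w`-stable interpolatory systems of `n` polynomials on `I`, whatever their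
nodes in `I` (in particular among those with the same nodes). -/
def IsMostEconomical {n : ℕ} (w : ℝ → ℝ) (I : Set ℝ) (x : Fin n → ℝ) (l : Fin n → ℝ[X]) :
    Prop :=
  IsStable w I x l ∧
    ∀ (x' : Fin n → ℝ) (l' : Fin n → ℝ[X]), IsStable w I x' l' →
      ∑ k, (l k).natDegree ≤ ∑ k, (l' k).natDegree

/-- The system `l_k(x)^2` of the Grünwald operator `f ↦ ∑ f(x_k) l_k(x)^2`, where `l_k` are the
fundamental polynomials of Lagrange interpolation on the nodes. -/
def grunwaldSystem {n : ℕ} (x : Fin n → ℝ) (k : Fin n) : ℝ[X] :=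
  Lagrange.basis Finset.univ x k ^ 2

end

/-! ### Laguerre polynomials -/

/-! Put `q = laguerre n (α - 1)`, `S = laguerreS m α`, `L = exceptionalLaguerreI m n α`, `P =
exceptionalFactor m n α`, and let `v` be the weight. Stability reduces to `∑ l_k² / v(x_k) ≤ 1 / v`
on `(0, ∞)`. The left side has degree at most `2n - 2` and equals `1 / v` at the nodes. The
differential equation of `L` says exactly that the derivatives agree there too
(`exceptionalLaguerreI_ode_at_root`), so the left side is the Hermite interpolant of `1 / v` on
double nodes. The interpolation error is a derivative of `1 / v` of order `2n` times a nonnegative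
square, so it suffices that even derivatives of `1 / v` be nonnegative.

They are, because `1 / v = e^x x^{-(α-1)} (S / (x P))²` is a mixture of exponentials `e^{xY}`, whose
derivatives of order `2n` are integrals of `Y^{2n} e^{xY}`. Such mixtures are closed under products.
The quotient `S / (x P)` is one because the zeros of `S` and of `P` interlace
(`isExpMixture_prod_div_prod`). Positions of all zeros come from sign changes of `L = (S + S') q - S
q'` at the zeros of `q` and of `S`.

For economy, every polynomial of a stable system is nonnegative on `(0, ∞)`, so it has double zeros
at the `n - 1` other nodes and degree at least `2(n - 1)`, which `l_k²` attains. -/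

theorem coeff_laguerre (k : ℕ) (β : ℝ) (i : ℕ) :
    (laguerre k β).coeff i = if i ≤ k then
      (-1) ^ i * ((ascPochhammer ℝ (k - i)).eval (β + i + 1) / (k - i).factorial) / i.factorial
      else 0 := by
  simp only [laguerre, finsetSum_coeff, coeff_C_mul_X_pow, Finset.sum_ite_eq, Finset.mem_range,
    Nat.lt_succ_iff]

theorem eval_ascPochhammer_succ (j : ℕ) (b : ℝ) :
    (ascPochhammer ℝ (j + 1)).eval b = b * (ascPochhammer ℝ j).eval (b + 1) := by
  rw [ascPochhammer_succ_left]
  simp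

theorem derivative_laguerre_succ (k : ℕ) (β : ℝ) :
    derivative (laguerre (k + 1) β) = -laguerre k (β + 1) := by
  ext i
  rw [coeff_derivative, coeff_neg, coeff_laguerre, coeff_laguerre]
  by_cases h : i ≤ k
  · rw [if_pos h, if_pos (by omega), Nat.add_sub_add_right, Nat.factorial_succ]
    have e : β + ((i + 1 : ℕ) : ℝ) + 1 = β + 1 + i + 1 := by push_cast; ring
    rw [e]
    have := Nat.factorial_ne_zero i
    have := Nat.factorial_ne_zero (k - i)
    push_cast
    field_simp
    ring
  · rw [if_neg h, if_neg (by omega)]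
    simp

theorem laguerre_zero (β : ℝ) : laguerre 0 β = 1 := by
  simp [laguerre]

/-- Pascal's rule on coefficients. It serves to express `exceptionalLaguerreI` through `laguerreS`,
one Laguerre polynomial and their derivatives. -/
theorem laguerre_add_one (k : ℕ) (β : ℝ) :
    laguerre k (β + 1) = laguerre k β - derivative (laguerre k β) := by
  cases k with
  | zero => simp [laguerre_zero]
  | succ k =>
    rw [derivative_laguerre_succ, sub_neg_eq_add]
    ext i
    rw [coeff_add, coeff_laguerre, coeff_laguerre, coeff_laguerre]
    rcases lt_trichotomy i (k + 1) with h | rfl | h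
    · obtain ⟨j, rfl⟩ : ∃ j, k = i + j := ⟨k - i, by omega⟩
      rw [if_pos (by omega), if_pos (by omega), if_pos (by omega),
        show i + j + 1 - i = j + 1 by omega, show i + j - i = j by omega,
        eval_ascPochhammer_succ j (β + i + 1), ascPochhammer_succ_eval, Nat.factorial_succ,
        show β + i + 1 + 1 = β + 1 + i + 1 by ring]
      have := Nat.factorial_ne_zero i
      have := Nat.factorial_ne_zero j
      push_cast
      field_simp
      ring
    · simp
    · rw [if_neg (by omega), if_neg (by omega), if_neg (by omega), add_zero]

theorem laguerre_ode (k : ℕ) (β : ℝ) :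
    X * derivative (derivative (laguerre k β)) + (C (β + 1) - X) * derivative (laguerre k β)
      + C (k : ℝ) * laguerre k β = 0 := by
  ext i
  -- The coefficient of `X ^ i` in the equation is this two-term recursion.
  have h : (i + 1) * (i + β + 1) * (laguerre k β).coeff (i + 1)
      = -((k : ℝ) - i) * (laguerre k β).coeff i := by
    rw [coeff_laguerre, coeff_laguerre]
    rcases lt_trichotomy i k with h | rfl | h
    · obtain ⟨j, rfl⟩ : ∃ j, k = i + j + 1 := ⟨k - i - 1, by omega⟩
      rw [if_pos (by omega), if_pos (by omega), show i + j + 1 - i = j + 1 by omega,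
        show i + j + 1 - (i + 1) = j by omega, eval_ascPochhammer_succ j (β + i + 1),
        Nat.factorial_succ, Nat.factorial_succ]
      have e : β + ((i + 1 : ℕ) : ℝ) + 1 = β + i + 1 + 1 := by push_cast; ring
      rw [e]
      have := Nat.factorial_ne_zero i
      have := Nat.factorial_ne_zero j
      push_cast
      field_simp
      ring
    · simp
    · simp [show ¬ i + 1 ≤ k by omega, show ¬ i ≤ k by omega]
  rw [sub_mul]
  simp only [coeff_add, coeff_sub, coeff_C_mul, coeff_zero]
  cases i with
  | zero =>
    simp only [mul_coeff_zero, coeff_X_zero, zero_mul, coeff_derivative]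
    push_cast at h ⊢
    linear_combination h
  | succ i =>
    simp only [coeff_X_mul, coeff_derivative]
    push_cast at h ⊢
    linear_combination h

theorem natDegree_laguerre_le (k : ℕ) (β : ℝ) : (laguerre k β).natDegree ≤ k := by
  rw [natDegree_le_iff_coeff_eq_zero]
  intro i hi
  rw [coeff_laguerre, if_neg (by omega)]

theorem coeff_laguerre_self (k : ℕ) (β : ℝ) :
    (laguerre k β).coeff k = (-1) ^ k / k.factorial := by
  simp [coeff_laguerre]

theorem natDegree_laguerre (k : ℕ) (β : ℝ) : (laguerre k β).natDegree = k := by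
  refine le_antisymm (natDegree_laguerre_le k β) (le_natDegree_of_ne_zero ?_)
  rw [coeff_laguerre_self]
  have := Nat.factorial_ne_zero k
  positivity

theorem leadingCoeff_laguerre (k : ℕ) (β : ℝ) :
    (laguerre k β).leadingCoeff = (-1) ^ k / k.factorial := by
  rw [leadingCoeff, natDegree_laguerre, coeff_laguerre_self]

theorem laguerre_eval_zero_pos (k : ℕ) {β : ℝ} (hβ : -1 < β) : 0 < (laguerre k β).eval 0 := by
  rw [← coeff_zero_eq_eval_zero, coeff_laguerre, if_pos (Nat.zero_le k)]
  have := ascPochhammer_pos k (β + (0 : ℕ) + 1) (by push_cast; linarith)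
  have := Nat.factorial_pos k
  simp only [pow_zero, one_mul, Nat.sub_zero, Nat.factorial_zero, Nat.cast_one, div_one]
  positivity

/-! ### Alternating signs and zeros -/

theorem exists_roots_of_alternating {n : ℕ} (p : ℝ[X]) (z : Fin (n + 1) → ℝ) (hz : StrictMono z)
    (h : ∀ i : Fin (n + 1), 0 < (-1) ^ (i : ℕ) * p.eval (z i)) :
    ∃ w : Fin n → ℝ, StrictMono w ∧
      ∀ i, z i.castSucc < w i ∧ w i < z i.succ ∧ p.eval (w i) = 0 := by
  have key : ∀ i : Fin n, ∃ w, z i.castSucc < w ∧ w < z i.succ ∧ p.eval w = 0 := by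
    intro i
    have hlt : z i.castSucc < z i.succ := hz i.castSucc_lt_succ
    have h1 := h i.castSucc
    have h2 := h i.succ
    simp only [Fin.val_castSucc, Fin.val_succ, pow_succ] at h1 h2
    have hc : ContinuousOn (fun t => (-1) ^ (i : ℕ) * p.eval t)
        (Set.Icc (z i.castSucc) (z i.succ)) := by fun_prop
    obtain ⟨w, hw, hw0⟩ := intermediate_value_Ioo' hlt.le hc
      (show (0 : ℝ) ∈ Set.Ioo _ _ from ⟨by linarith, h1⟩)
    exact ⟨w, hw.1, hw.2, by simpa using hw0⟩
  choose w hw using key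
  refine ⟨w, ?_, hw⟩
  intro i j hij
  have : z i.succ ≤ z j.castSucc := hz.monotone (Fin.succ_le_castSucc_iff.2 hij)
  linarith [(hw i).2.1, (hw j).1]

theorem exists_alternating_at_infinity {p : ℝ[X]} {n : ℕ} (h : 0 < (-1) ^ n * p.leadingCoeff)
    (a : ℝ) : ∃ M, a < M ∧ 0 < (-1) ^ n * p.eval M := by
  have h0 : (-1 : ℝ) ^ n ≠ 0 := by positivity
  have hl : 0 < (C ((-1) ^ n) * p).leadingCoeff := by
    rwa [leadingCoeff_mul, leadingCoeff_C]
  have : ∀ᶠ x in Filter.atTop, 0 < (C ((-1) ^ n) * p).eval x := by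
    by_cases hd : 0 < (C ((-1) ^ n) * p).degree
    · exact (tendsto_atTop_of_leadingCoeff_nonneg _ hd hl.le).eventually_gt_atTop 0
    · rw [eq_C_of_degree_le_zero (not_lt.1 hd)] at hl ⊢
      exact Filter.Eventually.of_forall fun x => by simpa using hl
  obtain ⟨M, hM, ha⟩ := (this.and (Filter.eventually_gt_atTop a)).exists
  exact ⟨M, ha, by simpa using hM⟩

theorem strictMono_snoc {n : ℕ} {z : Fin n → ℝ} (hz : StrictMono z) {M : ℝ} (hM : ∀ i, z i < M) :
    StrictMono (Fin.snoc z M : Fin (n + 1) → ℝ) := by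
  intro i j hij
  induction j using Fin.lastCases with
  | last =>
    induction i using Fin.lastCases with
    | last => exact absurd hij (lt_irrefl _)
    | cast i => simpa using hM i
  | cast j =>
    induction i using Fin.lastCases with
    | last => exact absurd (hij.trans (Fin.castSucc_lt_last j)) (lt_irrefl _)
    | cast i => simpa using hz (by simpa using hij)

theorem strictMono_cons {n : ℕ} {z : Fin n → ℝ} (hz : StrictMono z) {a : ℝ} (ha : ∀ i, a < z i) :
    StrictMono (Fin.cons a z : Fin (n + 1) → ℝ) := by
  intro i j hij
  induction j using Fin.cases with
  | zero => exact absurd hij (Fin.not_lt_zero i)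
  | succ j =>
    induction i using Fin.cases with
    | zero => simpa using ha j
    | succ i => simpa using hz (by simpa using hij)

/-- A polynomial with alternating signs at `n` increasing points and at infinity has a zero to the
right of each of these points and to the left of the next one. -/
theorem exists_roots_interlacing {n : ℕ} (p : ℝ[X]) (z : Fin n → ℝ) (hz : StrictMono z)
    (h : ∀ i : Fin n, 0 < (-1) ^ (i : ℕ) * p.eval (z i)) (hp : 0 < (-1) ^ n * p.leadingCoeff) :
    ∃ w : Fin n → ℝ, StrictMono w ∧ (∀ i, z i < w i) ∧ (∀ i j, i < j → w i < z j) ∧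
      ∀ i, p.eval (w i) = 0 := by
  obtain ⟨a, ha⟩ : ∃ a, ∀ i, z i ≤ a := by
    obtain ⟨a, ha⟩ := (Set.finite_range z).bddAbove
    exact ⟨a, fun i => ha (Set.mem_range_self i)⟩
  obtain ⟨M, hM, hpM⟩ := exists_alternating_at_infinity hp a
  obtain ⟨w, hw, hr⟩ := exists_roots_of_alternating p (Fin.snoc z M)
    (strictMono_snoc hz fun i => (ha i).trans_lt hM) (by
      intro i
      induction i using Fin.lastCases with
      | last => simpa using hpM
      | cast i => simpa using h i)
  refine ⟨w, hw, fun i => by simpa using (hr i).1, ?_, fun i => (hr i).2.2⟩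
  intro i j hij
  refine (hr i).2.1.trans_le ?_
  have := (strictMono_snoc hz fun i => (ha i).trans_lt hM).monotone
    (Fin.succ_le_castSucc_iff.2 hij)
  simpa using this

/-- Exactly `i` of the factors, those with `j < i`, are negative. -/
theorem prod_erase_sub_sign {n : ℕ} (z : Fin n → ℝ) (hz : StrictMono z) (i : Fin n) :
    0 < (-1) ^ (i : ℕ) * ∏ j ∈ Finset.univ.erase i, (z j - z i) := by
  have h1 : (-1 : ℝ) ^ (i : ℕ) = ∏ j ∈ Finset.univ.erase i, (if j < i then (-1 : ℝ) else 1) := by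
    rw [Finset.prod_ite, Finset.prod_const_one, mul_one, Finset.prod_const]
    congr 1
    rw [← Fin.card_Iio i]
    congr 1
    ext j
    simp only [Finset.mem_Iio, Finset.mem_filter, Finset.mem_erase, Finset.mem_univ, and_true]
    exact ⟨fun h => ⟨h.ne, h⟩, fun h => h.2⟩
  rw [h1, ← Finset.prod_mul_distrib]
  refine Finset.prod_pos fun j hj => ?_
  split_ifs with hji
  · have := hz hji
    linarith
  · have := hz (lt_of_le_of_ne (not_lt.1 hji) (Finset.ne_of_mem_erase hj).symm)
    linarith

theorem eval_derivative_prod_root {n : ℕ} (g : Fin n → ℝ[X]) (i : Fin n) (a : ℝ)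
    (hg : (g i).eval a = 0) :
    (derivative (∏ j, g j)).eval a
      = (derivative (g i)).eval a * ∏ j ∈ Finset.univ.erase i, (g j).eval a := by
  rw [← Finset.mul_prod_erase Finset.univ g (Finset.mem_univ i), derivative_mul]
  simp [hg, eval_prod]

theorem eq_C_mul_prod_of_roots {ι : Type*} [Fintype ι] (p : ℝ[X])
    (hp : p.natDegree = Fintype.card ι) (z : ι → ℝ)
    (hz : Function.Injective z) (hr : ∀ i, p.eval (z i) = 0) :
    p = C p.leadingCoeff * ∏ i, (X - C (z i)) := by
  by_cases h0 : p = 0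
  · simp [h0]
  have hm : (∏ i, (X - C (z i))).Monic := monic_prod_of_monic _ _ fun i _ => monic_X_sub_C _
  have hdvd : (∏ i, (X - C (z i))) ∣ p :=
    Finset.prod_dvd_of_coprime
      (fun i _ j _ hij => isCoprime_X_sub_C_of_isUnit_sub (sub_ne_zero.2 (hz.ne hij)).isUnit)
      (fun i _ => dvd_iff_isRoot.2 (hr i))
  have hd : (∏ i, (X - C (z i))).natDegree = Fintype.card ι := by
    simp [natDegree_prod_of_monic _ _ fun i _ => monic_X_sub_C (z i)]
  exact eq_leadingCoeff_mul_of_monic_of_dvd_of_natDegree_le hm hdvd (by rw [hp, hd])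

/-! ### Zeros of Laguerre polynomials -/

theorem laguerre_eq_prod_of_roots {k : ℕ} {β : ℝ} {z : Fin k → ℝ} (hz : StrictMono z)
    (hr : ∀ i, (laguerre k β).eval (z i) = 0) :
    laguerre k β = C (1 / (k.factorial : ℝ)) * ∏ i, (C (z i) - X) := by
  have h := eq_C_mul_prod_of_roots _ (by rw [natDegree_laguerre, Fintype.card_fin]) z hz.injective hr
  rw [h, leadingCoeff_laguerre]
  have : ∏ i, (C (z i) - X) = (-1) ^ k * ∏ i, (X - C (z i)) := by
    rw [← Fin.prod_const, ← Finset.prod_mul_distrib]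
    exact Finset.prod_congr rfl fun i _ => by ring
  rw [this, ← mul_assoc, show ((-1) ^ k : ℝ[X]) = C ((-1) ^ k) by simp, ← C_mul]
  congr 2
  ring

theorem laguerre_derivative_sign {k : ℕ} {β : ℝ} {z : Fin k → ℝ} (hz : StrictMono z)
    (h : laguerre k β = C (1 / (k.factorial : ℝ)) * ∏ i, (C (z i) - X)) (i : Fin k) :
    (-1) ^ (i : ℕ) * (derivative (laguerre k β)).eval (z i) < 0 := by
  have hs := prod_erase_sub_sign z hz i
  have hk : (0 : ℝ) < 1 / k.factorial := by positivity
  rw [h, derivative_C_mul, eval_mul, eval_C, eval_derivative_prod_root _ i _ (by simp)]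
  simp only [derivative_sub, derivative_C, derivative_X, eval_sub, eval_C, eval_X, eval_zero,
    eval_one]
  nlinarith [mul_pos hk hs]

/-- Induction on the degree, raising the parameter: the derivative of `laguerre (k + 1) β` is
`-laguerre k (β + 1)`, so the differential equation gives the values of `laguerre (k + 1) β` at the
zeros of `laguerre k (β + 1)`. Together with the positive value at `0`, the signs alternate. -/
theorem exists_laguerre_roots (k : ℕ) (β : ℝ) (hβ : -1 < β) :
    ∃ z : Fin k → ℝ, StrictMono z ∧ (∀ i, 0 < z i) ∧
      laguerre k β = C (1 / (k.factorial : ℝ)) * ∏ i, (C (z i) - X) := by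
  induction k generalizing β with
  | zero => exact ⟨Fin.elim0, fun i => i.elim0, fun i => i.elim0, by simp [laguerre_zero]⟩
  | succ k ih =>
    obtain ⟨z, hz, hpos, hq⟩ := ih (β + 1) (by linarith)
    have hstep : ∀ t, (k + 1) * (laguerre (k + 1) β).eval t
        = t * (derivative (laguerre k (β + 1))).eval t
          + (β + 1 - t) * (laguerre k (β + 1)).eval t := by
      intro t
      have := congrArg (eval t) (laguerre_ode (k + 1) β)
      rw [derivative_laguerre_succ] at this
      simp at this
      linear_combination this
    have hk : (0 : ℝ) < k + 1 := by positivity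
    obtain ⟨w, hw, hlt, -, hr⟩ := exists_roots_interlacing (laguerre (k + 1) β) (Fin.cons 0 z)
      (strictMono_cons hz hpos) (by
        intro i
        induction i using Fin.cases with
        | zero => simpa using laguerre_eval_zero_pos (k + 1) hβ
        | succ i =>
          have h1 := laguerre_derivative_sign hz hq i
          have h2 := hstep (z i)
          have h3 : (laguerre k (β + 1)).eval (z i) = 0 := by
            rw [hq, eval_mul, eval_prod, Finset.prod_eq_zero (Finset.mem_univ i) (by simp),
              mul_zero]
          rw [h3, mul_zero, add_zero] at h2
          simp only [Fin.cons_succ, Fin.val_succ, pow_succ]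
          have h4 := mul_neg_of_pos_of_neg (hpos i) h1
          refine pos_of_mul_pos_right (a := (k + 1 : ℝ)) ?_ hk.le
          calc (0 : ℝ) < -(z i * ((-1) ^ (i : ℕ)
                * (derivative (laguerre k (β + 1))).eval (z i))) := by linarith
            _ = _ := by linear_combination ((-1) ^ (i : ℕ)) * h2)
      (by
        rw [leadingCoeff_laguerre, ← mul_div_assoc, ← mul_pow]
        simp only [mul_neg, mul_one, neg_neg, one_pow]
        positivity)
    refine ⟨w, hw, fun i => lt_of_le_of_lt ?_ (hlt i), laguerre_eq_prod_of_roots hw hr⟩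
    induction i using Fin.cases with
    | zero => simp
    | succ i => simpa using (hpos i).le

/-! ### Mixtures of exponentials -/

/-- `f` is on `(0, ∞)` a moment generating function, that is, a mixture of the exponentials
`x ↦ exp (x * t)` with respect to some positive measure. -/
def IsExpMixture (f : ℝ → ℝ) : Prop :=
  ∃ (Ω : Type) (_ : MeasurableSpace Ω) (μ : MeasureTheory.Measure Ω)
    (_ : MeasureTheory.SFinite μ) (Y : Ω → ℝ), ∀ x, 0 < x →
      MeasureTheory.Integrable (fun ω => Real.exp (x * Y ω)) μ ∧
        ∫ ω, Real.exp (x * Y ω) ∂μ = f x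

theorem IsExpMixture.congr {f g : ℝ → ℝ} (hf : IsExpMixture f) (h : ∀ x, 0 < x → f x = g x) :
    IsExpMixture g := by
  obtain ⟨Ω, _, μ, _, Y, hY⟩ := hf
  exact ⟨Ω, _, μ, ‹_›, Y, fun x hx => ⟨(hY x hx).1, (hY x hx).2.trans (h x hx)⟩⟩

/-- Exponents add over the product measure; this is where s-finiteness is used. -/
theorem IsExpMixture.mul {f g : ℝ → ℝ} (hf : IsExpMixture f) (hg : IsExpMixture g) :
    IsExpMixture (fun x => f x * g x) := by
  obtain ⟨Ω, _, μ, _, Y, hY⟩ := hf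
  obtain ⟨Ω', _, ν, _, Z, hZ⟩ := hg
  refine ⟨Ω × Ω', _, μ.prod ν, inferInstance, fun p => Y p.1 + Z p.2, fun x hx => ?_⟩
  simp only [mul_add, Real.exp_add]
  refine ⟨(hY x hx).1.mul_prod (hZ x hx).1, ?_⟩
  rw [MeasureTheory.integral_prod_mul (fun ω => Real.exp (x * Y ω)) (fun ω => Real.exp (x * Z ω)),
    (hY x hx).2, (hZ x hx).2]

theorem isExpMixture_exp : IsExpMixture Real.exp :=
  ⟨Unit, inferInstance, MeasureTheory.Measure.dirac (), inferInstance, fun _ => 1, fun x _ => by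
    simp⟩

theorem isExpMixture_one : IsExpMixture (fun _ => 1) :=
  ⟨Unit, inferInstance, MeasureTheory.Measure.dirac (), inferInstance, fun _ => 0, fun x _ => by
    simp⟩

theorem IsExpMixture.const_mul {f : ℝ → ℝ} (hf : IsExpMixture f) {c : ℝ} (hc : 0 ≤ c) :
    IsExpMixture (fun x => c * f x) := by
  obtain ⟨Ω, _, μ, _, Y, hY⟩ := hf
  refine ⟨Ω, _, ENNReal.ofReal c • μ, inferInstance, Y, fun x hx =>
    ⟨(hY x hx).1.smul_measure ENNReal.ofReal_ne_top, ?_⟩⟩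
  rw [MeasureTheory.integral_smul_measure, (hY x hx).2, ENNReal.toReal_ofReal hc, smul_eq_mul]

/-- An extra atom of mass one with exponent `0` contributes the constant. -/
theorem IsExpMixture.one_add {f : ℝ → ℝ} (hf : IsExpMixture f) :
    IsExpMixture (fun x => 1 + f x) := by
  obtain ⟨Ω, _, μ, _, Y, hY⟩ := hf
  have hm : MeasurableEmbedding (Sum.inl : Ω → Ω ⊕ Unit) := 
    ⟨Sum.inl_injective, measurable_inl, fun _ => MeasurableSet.inl_image⟩
  have hm' : MeasurableEmbedding (Sum.inr : Unit → Ω ⊕ Unit) := 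
    ⟨Sum.inr_injective, measurable_inr, fun _ => MeasurableSet.inr_image⟩
  refine ⟨Ω ⊕ Unit, inferInstance,
    (MeasureTheory.Measure.dirac ()).map Sum.inr + μ.map Sum.inl, inferInstance, Sum.elim Y 0,
    fun x hx => ?_⟩
  have h1 : MeasureTheory.Integrable (fun ω : Ω ⊕ Unit => Real.exp (x * Sum.elim Y 0 ω))
      (μ.map Sum.inl) := hm.integrable_map_iff.2 (hY x hx).1
  have h2 : MeasureTheory.Integrable (fun ω : Ω ⊕ Unit => Real.exp (x * Sum.elim Y 0 ω))
      ((MeasureTheory.Measure.dirac ()).map Sum.inr) :=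
    hm'.integrable_map_iff.2 (MeasureTheory.integrable_dirac (by simp))
  refine ⟨MeasureTheory.integrable_add_measure.2 ⟨h2, h1⟩, ?_⟩
  rw [MeasureTheory.integral_add_measure h2 h1, hm.integral_map, hm'.integral_map]
  simp [(hY x hx).2]

/-- Euler's integral: `Γ(b) (x + p)^{-b}` is the integral of `t^{b-1} e^{-pt} e^{-xt}` over `t > 0`.
-/
theorem isExpMixture_rpow (p b : ℝ) (hp : 0 ≤ p) (hb : 0 < b) :
    IsExpMixture (fun x => (x + p) ^ (-b)) := by
  have hG := Real.Gamma_pos_of_pos hb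
  have hint : ∀ x : ℝ, 0 < x →
      ∫ t in Set.Ioi (0 : ℝ), Real.exp (-(p * t)) * t ^ (b - 1) * Real.exp (x * -t)
        = (x + p) ^ (-b) * Real.Gamma b := by
    intro x hx
    have hxp : 0 < x + p := by linarith
    have := Real.integral_rpow_mul_exp_neg_mul_Ioi hb hxp
    rw [one_div, Real.inv_rpow hxp.le, ← Real.rpow_neg hxp.le] at this
    rw [← this]
    refine MeasureTheory.setIntegral_congr_fun measurableSet_Ioi fun t _ => ?_
    rw [show -((x + p) * t) = -(p * t) + x * -t by ring, Real.exp_add]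
    ring
  have hmeas : Measurable fun t : ℝ => Real.toNNReal (Real.exp (-(p * t)) * t ^ (b - 1)) := by
    fun_prop
  have hmix : IsExpMixture (fun x => (x + p) ^ (-b) * Real.Gamma b) := by
    refine ⟨ℝ, inferInstance, (MeasureTheory.volume.restrict (Set.Ioi 0)).withDensity
      (fun t => (Real.toNNReal (Real.exp (-(p * t)) * t ^ (b - 1)) : ENNReal)), inferInstance,
      fun t => -t, fun x hx => ?_⟩
    have hval : ∫ t in Set.Ioi (0 : ℝ), Real.toNNReal (Real.exp (-(p * t)) * t ^ (b - 1)) •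
        Real.exp (x * -t) = (x + p) ^ (-b) * Real.Gamma b := by
      rw [← hint x hx]
      refine MeasureTheory.setIntegral_congr_fun measurableSet_Ioi fun t ht => ?_
      have : 0 ≤ Real.exp (-(p * t)) * t ^ (b - 1) :=
        mul_nonneg (Real.exp_pos _).le (Real.rpow_nonneg (le_of_lt ht) _)
      simp only [NNReal.smul_def, smul_eq_mul, Real.coe_toNNReal _ this]
    constructor
    · rw [MeasureTheory.integrable_withDensity_iff_integrable_smul hmeas]
      -- The integral of a non-integrable function is `0` by convention, so a nonzero value proves
      -- integrability.
      refine MeasureTheory.Integrable.of_integral_ne_zero ?_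
      rw [hval]
      have : 0 < (x + p) ^ (-b) := Real.rpow_pos_of_pos (by linarith) _
      positivity
    · rw [integral_withDensity_eq_integral_smul hmeas, hval]
  refine (hmix.const_mul (inv_nonneg.2 hG.le)).congr fun x _ => ?_
  field_simp

theorem isExpMixture_inv (p : ℝ) (hp : 0 ≤ p) : IsExpMixture (fun x => (x + p)⁻¹) := by
  refine (isExpMixture_rpow p 1 hp one_pos).congr fun x hx => ?_
  rw [Real.rpow_neg_one]

theorem IsExpMixture.prod {ι : Type*} (s : Finset ι) (f : ι → ℝ → ℝ)
    (h : ∀ i ∈ s, IsExpMixture (f i)) : IsExpMixture (fun x => ∏ i ∈ s, f i x) := by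
  classical
  induction s using Finset.induction_on with
  | empty => simpa using isExpMixture_one
  | insert a s ha ih =>
    simp only [Finset.prod_insert ha]
    exact (h a (Finset.mem_insert_self a s)).mul
      (ih fun i hi => h i (Finset.mem_insert_of_mem hi))

/-- Shift the pairing: each `x + s i` goes over the preceding denominator factor, the first over
`x`. Interlacing makes each quotient `1 + c / (x + t)` with `c ≥ 0`, and the last denominator factor
is left over. -/
theorem isExpMixture_prod_div_prod {m : ℕ} (s p : Fin m → ℝ) (hs : ∀ i, 0 < s i)
    (hp : ∀ i, 0 < p i) (hps : ∀ i j, i < j → p i < s j) :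
    IsExpMixture (fun x => (∏ i, (x + s i)) / (x * ∏ i, (x + p i))) := by
  set t : Fin (m + 1) → ℝ := Fin.cons 0 p with ht
  have ht0 : ∀ i, 0 ≤ t i := by
    intro i
    induction i using Fin.cases with
    | zero => simp [ht]
    | succ i => simpa [ht] using (hp i).le
  have hts : ∀ i : Fin m, t i.castSucc ≤ s i := by
    intro i
    obtain _ | m := m
    · exact i.elim0
    induction i using Fin.cases with
    | zero => simpa [ht] using (hs 0).le
    | succ i =>
      rw [← Fin.succ_castSucc]
      simpa [ht] using (hps _ _ i.castSucc_lt_succ).le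
  refine IsExpMixture.congr ((IsExpMixture.prod Finset.univ
    (fun (i : Fin m) x => 1 + (s i - t i.castSucc) * (x + t i.castSucc)⁻¹) fun i _ =>
      ((isExpMixture_inv _ (ht0 _)).const_mul (sub_nonneg.2 (hts i))).one_add).mul
      (isExpMixture_inv (t (Fin.last m)) (ht0 _))) fun x hx => ?_
  have hxt : ∀ i, x + t i ≠ 0 := fun i => (add_pos_of_pos_of_nonneg hx (ht0 i)).ne'
  have e1 : x * ∏ i, (x + p i) = (∏ i : Fin m, (x + t i.castSucc)) * (x + t (Fin.last m)) := by
    rw [← Fin.prod_univ_castSucc (fun i => x + t i), Fin.prod_univ_succ]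
    simp [ht]
  have e2 : ∀ i : Fin m, 1 + (s i - t i.castSucc) * (x + t i.castSucc)⁻¹
      = (x + s i) / (x + t i.castSucc) := by
    intro i
    have := hxt i.castSucc
    field_simp
    ring
  rw [e1, Finset.prod_congr rfl fun i _ => e2 i, Finset.prod_div_distrib]
  have := hxt (Fin.last m)
  have := Finset.prod_ne_zero_iff.2 fun (i : Fin m) (_ : i ∈ Finset.univ) => hxt i.castSucc
  field_simp

/-! ### Rolle's theorem and Hermite interpolation -/

/-- Disjointness from `Z` is recorded so that zeros of `f'` already known at points of `Z` can be
counted in addition. -/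
theorem rolle_finset {f f' : ℝ → ℝ} (hf : ∀ x, 0 < x → HasDerivAt f (f' x) x) (k : ℕ)
    (Z : Finset ℝ) (hZ : Z.card = k + 1) (hpos : ∀ z ∈ Z, 0 < z) (h0 : ∀ z ∈ Z, f z = 0) :
    ∃ W : Finset ℝ, W.card = k ∧ Disjoint W Z ∧ ∀ w ∈ W, 0 < w ∧ f' w = 0 := by
  set e := Z.orderEmbOfFin hZ with he
  have hmem : ∀ i, e i ∈ Z := Z.orderEmbOfFin_mem hZ
  have key : ∀ i : Fin k, ∃ w, e i.castSucc < w ∧ w < e i.succ ∧ f' w = 0 := by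
    intro i
    have hlt : e i.castSucc < e i.succ := e.strictMono i.castSucc_lt_succ
    obtain ⟨w, hw, hw0⟩ := exists_hasDerivAt_eq_zero hlt
      (fun y hy => (hf y ((hpos _ (hmem _)).trans_le hy.1)).continuousAt.continuousWithinAt)
      (by rw [h0 _ (hmem _), h0 _ (hmem _)])
      (fun y hy => hf y ((hpos _ (hmem _)).trans hy.1))
    exact ⟨w, hw.1, hw.2, hw0⟩
  choose w hw using key
  have hwm : StrictMono w := by
    intro i j hij
    have : e i.succ ≤ e j.castSucc := e.monotone (Fin.succ_le_castSucc_iff.2 hij)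
    linarith [(hw i).2.1, (hw j).1]
  refine ⟨Finset.univ.map ⟨w, hwm.injective⟩, by simp, ?_, ?_⟩
  · rw [Finset.disjoint_left]
    intro y hy hyZ
    obtain ⟨i, -, rfl⟩ := Finset.mem_map.1 hy
    obtain ⟨j, hj⟩ : ∃ j, e j = w i := by
      have : w i ∈ Set.range e := by rw [he, Finset.range_orderEmbOfFin]; exact hyZ
      exact this
    have h1 := (hw i).1
    have h2 := (hw i).2.1
    rw [← hj] at h1 h2
    have h3 := Fin.castSucc_lt_iff_succ_le.1 (e.lt_iff_lt.1 h1)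
    exact absurd (e.lt_iff_lt.1 h2) (not_lt.2 h3)
  · intro y hy
    obtain ⟨i, -, rfl⟩ := Finset.mem_map.1 hy
    exact ⟨(hpos _ (hmem _)).trans (hw i).1, (hw i).2.2⟩

theorem rolle_iterate (k : ℕ) : ∀ (F : ℕ → ℝ → ℝ)
    (_ : ∀ j x, 0 < x → HasDerivAt (F j) (F (j + 1) x) x)
    (Z : Finset ℝ) (_ : Z.card = k + 1) (_ : ∀ z ∈ Z, 0 < z) (_ : ∀ z ∈ Z, F 0 z = 0),
    ∃ w, 0 < w ∧ F k w = 0 := by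
  induction k with
  | zero =>
    intro F _ Z hZ hpos h0
    obtain ⟨z, hz⟩ := Finset.card_pos.1 (by omega : 0 < Z.card)
    exact ⟨z, hpos z hz, h0 z hz⟩
  | succ k ih =>
    intro F hF Z hZ hpos h0
    obtain ⟨W, hW, -, hWr⟩ := rolle_finset (hF 0) (k + 1) Z hZ hpos h0
    exact ih (fun j => F (j + 1)) (fun j => hF (j + 1)) W hW (fun w hw => (hWr w hw).1)
      fun w hw => (hWr w hw).2

/-- A function with nonnegative derivative of order `2n` dominates its Hermite interpolation
polynomial on `n` double nodes. -/
theorem hermite_le {n : ℕ} (hn : 0 < n) (F : ℕ → ℝ → ℝ)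
    (hF : ∀ j x, 0 < x → HasDerivAt (F j) (F (j + 1) x) x)
    (hF0 : ∀ x, 0 < x → 0 ≤ F (2 * n) x) (x : Fin n → ℝ) (hx : Function.Injective x)
    (hpos : ∀ i, 0 < x i) (H : ℝ[X]) (hH : H.natDegree < 2 * n)
    (h0 : ∀ i, H.eval (x i) = F 0 (x i)) (h1 : ∀ i, (derivative H).eval (x i) = F 1 (x i))
    (t : ℝ) (ht : 0 < t) : H.eval t ≤ F 0 t := by
  by_cases htx : ∃ i, x i = t
  · obtain ⟨i, rfl⟩ := htx
    exact (h0 i).le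
  push Not at htx
  set Q : ℝ[X] := ∏ i, (X - C (x i)) with hQ
  have hQm : Q.Monic := monic_prod_of_monic _ _ fun i _ => monic_X_sub_C _
  have hQd : Q.natDegree = n := by
    simp [hQ, natDegree_prod_of_monic _ _ fun i _ => monic_X_sub_C (x i)]
  have hQx : ∀ i, Q.eval (x i) = 0 := fun i => by
    rw [hQ, eval_prod, Finset.prod_eq_zero (Finset.mem_univ i) (by simp)]
  have hQt : Q.eval t ≠ 0 := by
    rw [hQ, eval_prod]
    exact Finset.prod_ne_zero_iff.2 fun i _ => by simpa using sub_ne_zero.2 (htx i).symm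
  -- This `K` makes `F 0 - H - K * Q ^ 2` vanish at `t` as well as doubly at the nodes; the goal
  -- becomes `0 ≤ K`.
  set K : ℝ := (F 0 t - H.eval t) / Q.eval t ^ 2 with hK
  set R : ℝ[X] := H + C K * Q ^ 2 with hR
  set G : ℕ → ℝ → ℝ := fun j y => F j y - (derivative^[j] R).eval y with hG
  have hGd : ∀ j y, 0 < y → HasDerivAt (G j) (G (j + 1) y) y := by
    intro j y hy
    simp only [hG, Function.iterate_succ_apply']
    exact (hF j y hy).sub (Polynomial.hasDerivAt _ _)
  have hG0 : ∀ i, G 0 (x i) = 0 := fun i => by simp [hG, hR, hQx, h0]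
  have hG1 : ∀ i, G 1 (x i) = 0 := fun i => by
    simp [hG, hR, hQx, h1, derivative_pow]
  have hGt : G 0 t = 0 := by
    simp only [hG, hR, Function.iterate_zero, id, eval_add, eval_mul, eval_C, eval_pow, hK]
    field_simp
    ring
  set N : Finset ℝ := Finset.univ.map ⟨x, hx⟩ with hN
  have hNc : N.card = n := by simp [hN]
  have htN : t ∉ N := by simpa [hN] using htx
  obtain ⟨W, hW, hWd, hWr⟩ := rolle_finset (hGd 0) n (insert t N)
    (by rw [Finset.card_insert_of_notMem htN, hNc])
    (by
      intro z hz
      rcases Finset.mem_insert.1 hz with rfl | hz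
      · exact ht
      · obtain ⟨i, -, rfl⟩ := Finset.mem_map.1 hz
        exact hpos i)
    (by
      intro z hz
      rcases Finset.mem_insert.1 hz with rfl | hz
      · exact hGt
      · obtain ⟨i, -, rfl⟩ := Finset.mem_map.1 hz
        exact hG0 i)
  have hdis : Disjoint W N := hWd.mono_right (Finset.subset_insert _ _)
  -- `G 1` has `2n` zeros: `n` from Rolle and the `n` nodes. Hence `G (2 * n)` has a zero `w`, and
  -- there `F (2 * n) w = K * (2 * n)!`.
  obtain ⟨w, hw, hw0⟩ := rolle_iterate (2 * n - 1) (fun j => G (j + 1)) (fun j => hGd (j + 1))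
    (W ∪ N) (by rw [Finset.card_union_of_disjoint hdis, hW, hNc]; omega)
    (by
      intro z hz
      rcases Finset.mem_union.1 hz with hz | hz
      · exact (hWr z hz).1
      · obtain ⟨i, -, rfl⟩ := Finset.mem_map.1 hz
        exact hpos i)
    (by
      intro z hz
      rcases Finset.mem_union.1 hz with hz | hz
      · exact (hWr z hz).2
      · obtain ⟨i, -, rfl⟩ := Finset.mem_map.1 hz
        exact hG1 i)
  rw [show 2 * n - 1 + 1 = 2 * n by omega] at hw0
  have hQ2 : (Q ^ 2).natDegree = 2 * n := by rw [hQm.natDegree_pow, hQd]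
  have hder : (derivative^[2 * n] R).eval w = K * (2 * n).factorial := by
    have e1 : derivative^[2 * n] H = 0 := iterate_derivative_eq_zero hH
    have e2 : derivative^[2 * n] (Q ^ 2) = C ((2 * n).factorial : ℝ) := by
      have hd : (derivative^[2 * n] (Q ^ 2)).natDegree = 0 := by
        have := natDegree_iterate_derivative (Q ^ 2) (2 * n)
        omega
      rw [eq_C_of_natDegree_eq_zero hd, coeff_iterate_derivative, zero_add,
        Nat.descFactorial_self]
      have : (Q ^ 2).coeff (2 * n) = 1 := by
        rw [← hQ2]
        exact (hQm.pow 2).coeff_natDegree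
      rw [this]
      simp
    rw [hR, _root_.iterate_map_add, iterate_derivative_C_mul, e1, e2]
    simp
  have hKnn : 0 ≤ K := by
    have h2 := hF0 w hw
    have h3 : F (2 * n) w = K * (2 * n).factorial := by
      rw [← hder]
      exact sub_eq_zero.1 hw0
    have : (0 : ℝ) < (2 * n).factorial := by positivity
    rw [h3] at h2
    exact nonneg_of_mul_nonneg_left h2 this
  have hsq : 0 < Q.eval t ^ 2 := by positivity
  have : F 0 t - H.eval t = K * Q.eval t ^ 2 := by rw [hK]; field_simp
  nlinarith [mul_nonneg hKnn hsq.le]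

/-- Differentiation under the integral multiplies the integrand by `Y`, so even orders give
nonnegative integrands. -/
theorem IsExpMixture.hermite_le {n : ℕ} (hn : 0 < n) {f : ℝ → ℝ} (hf : IsExpMixture f)
    {x : Fin n → ℝ} (hx : Function.Injective x) (hpos : ∀ i, 0 < x i) (H : ℝ[X])
    (hH : H.natDegree < 2 * n) (h0 : ∀ i, H.eval (x i) = f (x i))
    (h1 : ∀ i, HasDerivAt f ((derivative H).eval (x i)) (x i)) (t : ℝ) (ht : 0 < t) :
    H.eval t ≤ f t := by
  obtain ⟨Ω, _, μ, _, Y, hY⟩ := hf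
  have hsub : Set.Ioi 0 ⊆ interior (ProbabilityTheory.integrableExpSet Y μ) :=
    interior_maximal (fun y hy => (hY y hy).1) isOpen_Ioi
  set F : ℕ → ℝ → ℝ := fun j y => ∫ ω, Y ω ^ j * Real.exp (y * Y ω) ∂μ with hFdef
  have hF : ∀ j y, 0 < y → HasDerivAt (F j) (F (j + 1) y) y := fun j y hy =>
    ProbabilityTheory.hasDerivAt_integral_pow_mul_exp_real (hsub hy) j
  have hFf : ∀ y, 0 < y → F 0 y = f y := fun y hy => by simp [hFdef, (hY y hy).2]
  rw [← hFf t ht]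
  refine _root_.hermite_le hn F hF ?_ x hx hpos H hH (fun i => (h0 i).trans (hFf _ (hpos i)).symm)
    (fun i => ?_) t ht
  · intro y _
    refine MeasureTheory.integral_nonneg fun ω => ?_
    rw [pow_mul]
    positivity
  · refine (h1 i).unique ((hF 0 _ (hpos i)).congr_of_eventuallyEq ?_)
    filter_upwards [Ioi_mem_nhds (hpos i)] with y hy using (hFf y hy).symm

/-! ### Exceptional Laguerre polynomials -/

theorem derivative_laguerreS (m : ℕ) (α : ℝ) :
    derivative (laguerreS m α) = -(derivative (laguerre m (α - 1))).comp (-X) := by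
  simp [laguerreS, derivative_comp]

theorem exceptionalLaguerreI_eq (m n : ℕ) (α : ℝ) :
    exceptionalLaguerreI m n α
      = (laguerreS m α + derivative (laguerreS m α)) * laguerre n (α - 1)
        - laguerreS m α * derivative (laguerre n (α - 1)) := by
  have h1 : (laguerre m α).comp (-X) = laguerreS m α + derivative (laguerreS m α) := by
    have := laguerre_add_one m (α - 1)
    rw [sub_add_cancel] at this
    rw [this, derivative_laguerreS, sub_comp, laguerreS, sub_eq_add_neg]
  cases n with
  | zero => simp [exceptionalLaguerreI, h1, laguerre_zero]
  | succ k =>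
    rw [exceptionalLaguerreI, h1, derivative_laguerre_succ, sub_add_cancel]
    ring

theorem laguerreS_ode (m : ℕ) (α : ℝ) :
    X * derivative (derivative (laguerreS m α)) + (C α + X) * derivative (laguerreS m α)
      - C (m : ℝ) * laguerreS m α = 0 := by
  have h := congrArg (fun p : ℝ[X] => p.comp (-X)) (laguerre_ode m (α - 1))
  simp only [derivative_laguerreS, derivative_neg, derivative_comp, derivative_X] at h ⊢
  simp only [add_comp, mul_comp, sub_comp, X_comp, C_comp, zero_comp, sub_add_cancel] at h
  rw [laguerreS]
  linear_combination -h

/-- An algebraic consequence of the equations of `laguerreS m α` and `laguerre n (α - 1)` and of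
their derivatives, with the derivatives of both polynomials treated as independent symbols. -/
theorem exceptionalLaguerreI_ode (m n : ℕ) (α : ℝ) :
    laguerreS m α * (X * derivative (derivative (exceptionalLaguerreI m n α))
        + (C (α + 1) - X) * derivative (exceptionalLaguerreI m n α))
      - 2 * X * derivative (laguerreS m α) * derivative (exceptionalLaguerreI m n α)
      = (-C ((m : ℝ) + n) * laguerreS m α + 2 * C α * derivative (laguerreS m α))
        * exceptionalLaguerreI m n α := by
  have hq := laguerre_ode n (α - 1)
  rw [sub_add_cancel] at hq
  have hs := laguerreS_ode m α
  have hq' := congrArg derivative hq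
  have hs' := congrArg derivative hs
  rw [exceptionalLaguerreI_eq]
  generalize laguerreS m α = S at *
  generalize laguerre n (α - 1) = q at *
  simp only [derivative_add, derivative_sub, derivative_mul, derivative_X, derivative_C,
    derivative_zero, C_add, C_1] at *
  generalize derivative (derivative (derivative S)) = S3 at *
  generalize derivative (derivative S) = S2 at *
  generalize derivative S = S1 at *
  generalize derivative (derivative (derivative q)) = q3 at *
  generalize derivative (derivative q) = q2 at *
  generalize derivative q = q1 at *
  linear_combination (S * q) * hs' - S ^ 2 * hq' + (S ^ 2 - S * S1 + 2 * S * S1) * hq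
    + (-S * q + S * q1 - 2 * S1 * q) * hs

theorem natDegree_laguerreS (m : ℕ) (α : ℝ) : (laguerreS m α).natDegree = m := by
  rw [laguerreS, natDegree_comp, natDegree_laguerre, natDegree_neg, natDegree_X, mul_one]

theorem leadingCoeff_laguerreS (m : ℕ) (α : ℝ) :
    (laguerreS m α).leadingCoeff = 1 / m.factorial := by
  rw [laguerreS, comp_neg_X_leadingCoeff_eq, natDegree_laguerre, leadingCoeff_laguerre,
    ← mul_div_assoc, ← mul_pow]
  simp

theorem exceptionalLaguerreI_leading (m n : ℕ) (α : ℝ) :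
    (exceptionalLaguerreI m n α).natDegree = m + n ∧
      (exceptionalLaguerreI m n α).leadingCoeff = 1 / m.factorial * ((-1) ^ n / n.factorial) := by
  have hS : laguerreS m α ≠ 0 := by
    rw [← leadingCoeff_ne_zero, leadingCoeff_laguerreS]
    positivity
  have hq : laguerre n (α - 1) ≠ 0 := by
    rw [← leadingCoeff_ne_zero, leadingCoeff_laguerre]
    positivity
  have hlt : (derivative (laguerreS m α) * laguerre n (α - 1)
      - laguerreS m α * derivative (laguerre n (α - 1))).degree
        < (laguerreS m α * laguerre n (α - 1)).degree := by
    refine (degree_sub_le _ _).trans_lt (max_lt ?_ ?_)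
    · rw [degree_mul, degree_mul]
      exact WithBot.add_lt_add_right (degree_ne_bot.2 hq) (degree_derivative_lt hS)
    · rw [degree_mul, degree_mul]
      exact WithBot.add_lt_add_left (degree_ne_bot.2 hS) (degree_derivative_lt hq)
  have e : exceptionalLaguerreI m n α = (derivative (laguerreS m α) * laguerre n (α - 1)
      - laguerreS m α * derivative (laguerre n (α - 1)))
        + laguerreS m α * laguerre n (α - 1) := by
    rw [exceptionalLaguerreI_eq]
    ring
  rw [e, leadingCoeff_add_of_degree_lt hlt, natDegree_add_eq_right_of_degree_lt hlt,
    natDegree_mul hS hq, natDegree_laguerre, natDegree_laguerreS, leadingCoeff_mul,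
    leadingCoeff_laguerre, leadingCoeff_laguerreS]
  exact ⟨rfl, rfl⟩

/-- The zeros of `S`, the exceptional zeros and the positive zeros of the exceptional Laguerre
polynomial; the zeros of `S` and the exceptional zeros interlace. -/
theorem exists_exceptional_roots (m n : ℕ) {α : ℝ} (hα : 0 < α) :
    ∃ (s p : Fin m → ℝ) (x : Fin n → ℝ), StrictMono x ∧ (∀ i, 0 < s i) ∧ (∀ i, 0 < p i) ∧
      (∀ i, 0 < x i) ∧ (∀ i j, i < j → p i < s j) ∧
      laguerreS m α = C (1 / (m.factorial : ℝ)) * ∏ i, (X + C (s i)) ∧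
      exceptionalFactor m n α = C (1 / (m.factorial : ℝ)) * ∏ i, (X + C (p i)) ∧
      exceptionalLaguerreI m n α = C ((-1) ^ n / (n.factorial : ℝ)) * (∏ i, (X - C (x i)))
        * exceptionalFactor m n α := by
  obtain ⟨s, hs, hs0, hsl⟩ := exists_laguerre_roots m (α - 1) (by linarith)
  obtain ⟨y, hy, hy0, hyl⟩ := exists_laguerre_roots n (α - 1) (by linarith)
  have hS : laguerreS m α = C (1 / (m.factorial : ℝ)) * ∏ i, (X + C (s i)) := by
    rw [laguerreS, hsl]
    simp [prod_comp, add_comm]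
  obtain ⟨hdeg, hlc⟩ := exceptionalLaguerreI_leading m n α
  have hSpos : ∀ t, 0 < t → 0 < (laguerreS m α).eval t := by
    intro t ht
    rw [hS, eval_mul, eval_C, eval_prod]
    refine mul_pos (by positivity) (Finset.prod_pos fun i _ => ?_)
    simpa using add_pos ht (hs0 i)
  have hqpos : ∀ t, t < 0 → 0 < (laguerre n (α - 1)).eval t := by
    intro t ht
    rw [hyl, eval_mul, eval_C, eval_prod]
    refine mul_pos (by positivity) (Finset.prod_pos fun i _ => ?_)
    simpa using ht.trans (hy0 i)
  -- At a zero of `q = laguerre n (α - 1)` the exceptional polynomial equals `-S q'`, where `S > 0`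
  -- and `q'` alternates.
  obtain ⟨x, hx, hyx, -, hxr⟩ := exists_roots_interlacing (exceptionalLaguerreI m n α) y hy (by
      intro i
      have h0 : (laguerre n (α - 1)).eval (y i) = 0 := by
        rw [hyl, eval_mul, eval_prod, Finset.prod_eq_zero (Finset.mem_univ i) (by simp), mul_zero]
      have h1 := mul_neg_of_pos_of_neg (hSpos _ (hy0 i)) (laguerre_derivative_sign hy hyl i)
      rw [exceptionalLaguerreI_eq, eval_sub, eval_mul, eval_mul, h0]
      linarith) (by
      rw [hlc, mul_left_comm, ← mul_div_assoc, ← mul_pow]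
      simp only [mul_neg, mul_one, neg_neg, one_pow]
      positivity)
  -- At a zero `-s i` of `S` the exceptional polynomial equals `S' q`, where `q > 0`. Reflecting by
  -- `-X` turns negative zeros into positive ones in increasing order.
  obtain ⟨p, hp, hsp, hps, hpr⟩ := exists_roots_interlacing
    ((exceptionalLaguerreI m n α).comp (-X)) s hs (by
      intro i
      have h0 : (laguerreS m α).eval (-s i) = 0 := by
        rw [hS, eval_mul, eval_prod, Finset.prod_eq_zero (Finset.mem_univ i) (by simp), mul_zero]
      have h1 := mul_neg_of_pos_of_neg (hqpos (-s i) (by linarith [hs0 i]))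
        (laguerre_derivative_sign hs hsl i)
      have h2 : (derivative (laguerreS m α)).eval (-s i)
          = -(derivative (laguerre m (α - 1))).eval (s i) := by
        rw [derivative_laguerreS]
        simp
      rw [eval_comp, eval_neg, eval_X, exceptionalLaguerreI_eq, eval_sub, eval_mul, eval_mul,
        eval_add, h0, h2]
      linarith) (by
      rw [comp_neg_X_leadingCoeff_eq, hlc, hdeg]
      have e : ∀ a b : ℝ, (-1 : ℝ) ^ m * ((-1) ^ (m + n) * (a * ((-1) ^ n / b)))
          = ((-1) ^ m * (-1) ^ m) * ((-1) ^ n * (-1) ^ n) * (a / b) := fun a b => by ring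
      rw [e, ← mul_pow, ← mul_pow]
      simp only [mul_neg, mul_one, neg_neg, one_pow, one_mul]
      positivity)
  have hx0 : ∀ i, 0 < x i := fun i => (hy0 i).trans (hyx i)
  have hp0 : ∀ i, 0 < p i := fun i => (hs0 i).trans (hsp i)
  have hL : exceptionalLaguerreI m n α = C (1 / (m.factorial : ℝ) * ((-1) ^ n / n.factorial))
      * ((∏ i, (X - C (x i))) * ∏ i, (X + C (p i))) := by
    -- The `n` positive and `m` negative zeros found exhaust the degree `m + n`, so all are simple
    -- and there are no others.
    have := eq_C_mul_prod_of_roots (exceptionalLaguerreI m n α)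
      (by simp [hdeg, add_comm]) (Sum.elim x (fun i => -p i))
      (hx.injective.sumElim (neg_injective.comp hp.injective) fun i j => by
        have := hx0 i
        have := hp0 j
        intro (h : x i = -p j)
        linarith)
      (by
        rintro (i | i)
        · exact hxr i
        · simpa using hpr i)
    rw [hlc, Fintype.prod_sum_type] at this
    simpa using this
  have hroots : (exceptionalLaguerreI m n α).roots
      = Finset.univ.val.map x + Finset.univ.val.map (fun i => -p i) := by
    have hc : 1 / (m.factorial : ℝ) * ((-1) ^ n / n.factorial) ≠ 0 := by positivity
    rw [hL, roots_C_mul _ hc, ← roots_multiset_prod_X_sub_C (Finset.univ.val.map x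
      + Finset.univ.val.map fun i => -p i)]
    rw [Multiset.map_add, Multiset.prod_add, Multiset.map_map, Multiset.map_map]
    congr 2
    exact congrArg Multiset.prod (Multiset.map_congr rfl fun i _ => by simp)
  have hP : exceptionalFactor m n α = C (1 / (m.factorial : ℝ)) * ∏ i, (X + C (p i)) := by
    have h1 : (Finset.univ.val.map x).filter (fun z => z < 0) = 0 := by
      rw [Multiset.filter_eq_nil]
      intro z hz
      obtain ⟨i, -, rfl⟩ := Multiset.mem_map.1 hz
      exact not_lt.2 (hx0 i).le
    have h2 : (Finset.univ.val.map fun i => -p i).filter (fun z => z < 0)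
        = Finset.univ.val.map fun i => -p i := by
      rw [Multiset.filter_eq_self]
      intro z hz
      obtain ⟨i, -, rfl⟩ := Multiset.mem_map.1 hz
      exact neg_lt_zero.2 (hp0 i)
    rw [exceptionalFactor, hroots, Multiset.filter_add, h1, h2, zero_add, Multiset.map_map]
    congr 1
    exact congrArg Multiset.prod (Multiset.map_congr rfl fun i _ => by simp)
  refine ⟨s, p, x, hx, hs0, hp0, hx0, hps, hS, hP, ?_⟩
  rw [hL, hP, C_mul]
  ring

/-! ### The Grünwald system -/

theorem X_sub_C_mul_lagrange_basis {n : ℕ} {x : Fin n → ℝ} (hx : Function.Injective x)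
    (k : Fin n) : ∃ d : ℝ, d ≠ 0 ∧
      ∏ i, (X - C (x i)) = C d * ((X - C (x k)) * Lagrange.basis Finset.univ x k) := by
  refine ⟨∏ j ∈ Finset.univ.erase k, (x k - x j), Finset.prod_ne_zero_iff.2 fun j hj =>
    sub_ne_zero.2 (hx.ne (Finset.ne_of_mem_erase hj).symm), ?_⟩
  rw [← Finset.mul_prod_erase Finset.univ _ (Finset.mem_univ k), mul_left_comm, map_prod,
    Lagrange.basis, ← Finset.prod_mul_distrib]
  congr 1
  refine Finset.prod_congr rfl fun j hj => ?_
  have : x k - x j ≠ 0 := sub_ne_zero.2 (hx.ne (Finset.ne_of_mem_erase hj).symm)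
  rw [Lagrange.basisDivisor, ← mul_assoc, ← C_mul, mul_inv_cancel₀ this, C_1, one_mul]

theorem lagrange_basis_eval {n : ℕ} {x : Fin n → ℝ} (hx : Function.Injective x) (k i : Fin n) :
    (Lagrange.basis Finset.univ x k).eval (x i) = if k = i then 1 else 0 := by
  split_ifs with h
  · subst h
    exact Lagrange.eval_basis_self hx.injOn (Finset.mem_univ _)
  · exact Lagrange.eval_basis_of_ne h (Finset.mem_univ _)

theorem natDegree_grunwaldSystem {n : ℕ} {x : Fin n → ℝ} (hx : Function.Injective x)
    (k : Fin n) : (grunwaldSystem x k).natDegree = 2 * (n - 1) := by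
  rw [grunwaldSystem, natDegree_pow,
    natDegree_eq_of_degree_eq_some (Lagrange.degree_basis hx.injOn (Finset.mem_univ k)),
    Finset.card_univ, Fintype.card_fin]

/-- A zero of a nonnegative function at an interior point is a local minimum, so the derivative
vanishes too. -/
theorem sq_dvd_of_nonneg {p : ℝ[X]} {a : ℝ} (ha : 0 < a) (h : ∀ t, 0 < t → 0 ≤ p.eval t)
    (h0 : p.eval a = 0) : (X - C a) ^ 2 ∣ p := by
  obtain ⟨r, rfl⟩ := dvd_iff_isRoot.2 h0
  have hmin : IsLocalMin (fun t => ((X - C a) * r).eval t) a := by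
    filter_upwards [Ioi_mem_nhds ha] with t ht
    rw [h0]
    exact h t ht
  have hd := hmin.hasDerivAt_eq_zero (Polynomial.hasDerivAt _ _)
  rw [derivative_mul] at hd
  simp at hd
  rw [pow_two]
  exact mul_dvd_mul_left _ (dvd_iff_isRoot.2 hd)

/-- The polynomials of a stable system have double zeros at the nodes of the other ones. -/
theorem IsStable.le_natDegree {n : ℕ} {w : ℝ → ℝ} {x : Fin n → ℝ} {l : Fin n → ℝ[X]}
    (h : IsStable w (Set.Ioi 0) x l) (k : Fin n) : 2 * (n - 1) ≤ (l k).natDegree := by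
  have hl : l k ≠ 0 := by
    intro h0
    have := h.interpolatory k k
    simp [h0] at this
  have hnn : ∀ t, 0 < t → 0 ≤ (l k).eval t := by
    intro t ht
    -- Data concentrated at one node isolate the single polynomial `l k`.
    have h1 := h.nonneg (Pi.single k 1) (fun j => by
      by_cases hj : j = k
      · subst hj; simp
      · simp [hj]) t ht
    rw [Finset.sum_eq_single k (fun j _ hj => by simp [hj]) (by simp), Pi.single_eq_same,
      mul_one] at h1
    have h2 := nonneg_of_mul_nonneg_right h1 (h.weight_pos t ht)
    rwa [le_div_iff₀ (h.weight_pos _ (h.nodes_mem k)), zero_mul] at h2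
  have hx : Function.Injective x := by
    intro i j hij
    by_contra hne
    have h1 := h.interpolatory i i
    have h2 := h.interpolatory i j
    rw [hij] at h1
    rw [h1, if_pos rfl, if_neg hne] at h2
    exact one_ne_zero h2
  have hdvd : ∏ j ∈ Finset.univ.erase k, (X - C (x j)) ^ 2 ∣ l k := by
    refine Finset.prod_dvd_of_coprime (fun i _ j _ hij => IsCoprime.pow
      (isCoprime_X_sub_C_of_isUnit_sub (sub_ne_zero.2 (hx.ne hij)).isUnit)) fun j hj => ?_
    refine sq_dvd_of_nonneg (h.nodes_mem j) hnn ?_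
    rw [h.interpolatory k j, if_neg (Finset.ne_of_mem_erase hj).symm]
  have := natDegree_le_of_dvd hdvd hl
  rw [natDegree_prod _ _ fun j _ => pow_ne_zero _ (X_sub_C_ne_zero _)] at this
  simp only [natDegree_pow, natDegree_X_sub_C, Finset.sum_const, smul_eq_mul,
    Finset.card_erase_of_mem (Finset.mem_univ k), Finset.card_univ, Fintype.card_fin] at this
  omega

/-- The lower bound on degrees does not depend on the nodes and is attained term by term. -/
theorem IsStable.isMostEconomical_grunwaldSystem {n : ℕ} {w : ℝ → ℝ} {x : Fin n → ℝ}
    (hx : Function.Injective x) (h : IsStable w (Set.Ioi 0) x (grunwaldSystem x)) :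
    IsMostEconomical w (Set.Ioi 0) x (grunwaldSystem x) :=
  ⟨h, fun _ _ h' => Finset.sum_le_sum fun k _ =>
    (natDegree_grunwaldSystem hx k).trans_le (h'.le_natDegree k)⟩

/-- If `1 / w` is a mixture of exponentials whose logarithmic derivative at each node is
`2 * l_k'`, then the Grünwald system is `w`-stable. -/
theorem isStable_grunwaldSystem {n : ℕ} {w : ℝ → ℝ} (hw : ∀ t, 0 < t → 0 < w t)
    (hmix : IsExpMixture fun t => (w t)⁻¹) {x : Fin n → ℝ} (hx : Function.Injective x)
    (hpos : ∀ i, 0 < x i)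
    (hd : ∀ i, HasDerivAt (fun t => (w t)⁻¹)
      ((w (x i))⁻¹ * (2 * (derivative (Lagrange.basis Finset.univ x i)).eval (x i))) (x i)) :
    IsStable w (Set.Ioi 0) x (grunwaldSystem x) := by
  have hnn : ∀ k t, 0 ≤ (grunwaldSystem x k).eval t / w (x k) := fun k t =>
    div_nonneg (by rw [grunwaldSystem, eval_pow]; exact sq_nonneg _) (hw _ (hpos k)).le
  have hle : ∀ t, 0 < t → ∑ k, (grunwaldSystem x k).eval t / w (x k) ≤ (w t)⁻¹ := by
    intro t ht
    rcases Nat.eq_zero_or_pos n with rfl | hn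
    · simpa using (hw t ht).le
    -- The Hermite interpolant of `1 / w`: at node `i` only the `i`-th summand contributes, both to
    -- the value and to the derivative.
    set H : ℝ[X] := ∑ k, C (w (x k))⁻¹ * grunwaldSystem x k with hH
    have hHt : ∀ u, H.eval u = ∑ k, (grunwaldSystem x k).eval u / w (x k) := fun u => by
      rw [hH, eval_finsetSum]
      exact Finset.sum_congr rfl fun k _ => by rw [eval_mul, eval_C, div_eq_inv_mul]
    rw [← hHt]
    refine hmix.hermite_le hn hx hpos H ?_ (fun i => ?_) (fun i => ?_) t ht
    · refine lt_of_le_of_lt (natDegree_sum_le_of_forall_le (n := 2 * (n - 1)) _ _ fun k _ => ?_)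
        (by omega)
      exact (natDegree_C_mul_le _ _).trans (natDegree_grunwaldSystem hx k).le
    · rw [hHt, Finset.sum_eq_single i (fun k _ hk => by
        simp [grunwaldSystem, lagrange_basis_eval hx, hk]) (by simp)]
      simp [grunwaldSystem, lagrange_basis_eval hx]
    · convert hd i using 1
      rw [hH, derivative_sum, eval_finsetSum, Finset.sum_eq_single i (fun k _ hk => by
        simp [grunwaldSystem, derivative_pow, lagrange_basis_eval hx, hk]) (by simp)]
      simp [grunwaldSystem, derivative_pow, lagrange_basis_eval hx]
  refine ⟨hw, hpos, fun k i => ?_, fun y hy t ht => ?_, fun y hy t ht => ?_⟩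
  · rw [grunwaldSystem, eval_pow, lagrange_basis_eval hx]
    split_ifs <;> simp
  · exact mul_nonneg (hw t ht).le
      (Finset.sum_nonneg fun k _ => mul_nonneg (hnn k t) (hy k))
  · have hY : ∀ k, y k ≤ ⨆ k, y k := fun k => le_ciSup (Set.finite_range y).bddAbove k
    have hY0 : 0 ≤ ⨆ k, y k := Real.iSup_nonneg hy
    calc w t * ∑ k, (grunwaldSystem x k).eval t / w (x k) * y k
        ≤ w t * ∑ k, (grunwaldSystem x k).eval t / w (x k) * ⨆ k, y k :=
          mul_le_mul_of_nonneg_left (Finset.sum_le_sum fun k _ =>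
            mul_le_mul_of_nonneg_left (hY k) (hnn k t)) (hw t ht).le
      _ = w t * (∑ k, (grunwaldSystem x k).eval t / w (x k)) * ⨆ k, y k := by
          rw [← Finset.sum_mul, mul_assoc]
      _ ≤ w t * (w t)⁻¹ * ⨆ k, y k := mul_le_mul_of_nonneg_right
          (mul_le_mul_of_nonneg_left (hle t ht) (hw t ht).le) hY0
      _ = ⨆ k, y k := by rw [mul_inv_cancel₀ (hw t ht).ne', one_mul]

/-! ### The weight `vWeight` and the main theorem -/

theorem hasDerivAt_inv_vWeight (m n : ℕ) (α : ℝ) {a : ℝ} (ha : 0 < a)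
    (hS : (laguerreS m α).eval a ≠ 0) (hP : (exceptionalFactor m n α).eval a ≠ 0) :
    HasDerivAt (fun t => (vWeight m n α t)⁻¹)
      ((vWeight m n α a)⁻¹ * (1 - (α + 1) / a
        + 2 * ((derivative (laguerreS m α)).eval a / (laguerreS m α).eval a)
        - 2 * ((derivative (exceptionalFactor m n α)).eval a
          / (exceptionalFactor m n α).eval a))) a := by
  have h1 : HasDerivAt (fun t : ℝ => t ^ (α + 1)) ((α + 1) * a ^ α) a := by
    simpa using Real.hasDerivAt_rpow_const (p := α + 1) (Or.inl ha.ne')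
  have h2 : HasDerivAt (fun t : ℝ => Real.exp (-t)) (-Real.exp (-a)) a := by
    simpa using (hasDerivAt_neg a).exp
  have hv : vWeight m n α a ≠ 0 := by
    have := (Real.rpow_pos_of_pos ha (α + 1)).ne'
    have := (Real.exp_pos (-a)).ne'
    rw [vWeight]
    positivity
  have h3 := (((h1.mul h2).mul (((exceptionalFactor m n α).hasDerivAt a).pow 2)).div
    (((laguerreS m α).hasDerivAt a).pow 2) (pow_ne_zero 2 hS)).inv hv
  refine HasDerivAt.congr_deriv (f := fun t => (vWeight m n α t)⁻¹) h3 ?_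
  have e : a ^ (α + 1) = a ^ α * a := Real.rpow_add_one ha.ne' α
  have := (Real.rpow_pos_of_pos ha α).ne'
  have := (Real.exp_pos (-a)).ne'
  simp only [vWeight, e, Pi.mul_apply, Pi.pow_apply, Pi.div_apply]
  field_simp
  ring

/-- Two powers of `t` are spent on the two factors `S / (t P)`; the remaining `t^{-(α-1)}` is a
Gamma mixture because `α > 1`. -/
theorem isExpMixture_inv_vWeight {m n : ℕ} {α : ℝ} (hα : 1 < α) {s p : Fin m → ℝ}
    (hs : ∀ i, 0 < s i) (hp : ∀ i, 0 < p i) (hps : ∀ i j, i < j → p i < s j)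
    (hS : laguerreS m α = C (1 / (m.factorial : ℝ)) * ∏ i, (X + C (s i)))
    (hP : exceptionalFactor m n α = C (1 / (m.factorial : ℝ)) * ∏ i, (X + C (p i))) :
    IsExpMixture fun t => (vWeight m n α t)⁻¹ := by
  have h1 := isExpMixture_prod_div_prod s p hs hp hps
  have h2 := isExpMixture_rpow 0 (α - 1) le_rfl (by linarith)
  refine ((isExpMixture_exp.mul h2).mul (h1.mul h1)).congr fun t ht => ?_
  have e : t ^ (α + 1) = t ^ (α - 1) * t ^ 2 := by
    rw [← Real.rpow_natCast t 2, ← Real.rpow_add ht]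
    norm_num
    ring_nf
  have hm : (m.factorial : ℝ) ≠ 0 := by positivity
  have hs' : ∏ i, (t + s i) ≠ 0 := Finset.prod_ne_zero_iff.2 fun i _ => (add_pos ht (hs i)).ne'
  have hp' : ∏ i, (t + p i) ≠ 0 := Finset.prod_ne_zero_iff.2 fun i _ => (add_pos ht (hp i)).ne'
  have := (Real.rpow_pos_of_pos ht (α - 1)).ne'
  have := (Real.exp_pos t).ne'
  rw [vWeight, hS, hP]
  simp only [eval_mul, eval_C, eval_prod, eval_add, eval_X, add_zero, Real.rpow_neg ht.le, e,
    Real.exp_neg]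
  field_simp

/-- The differential equation of the exceptional Laguerre polynomial at one of its positive
zeros `a`, in terms of the corresponding fundamental polynomial `l`. -/
theorem exceptionalLaguerreI_ode_at_root {m n : ℕ} {α a c : ℝ} {l : ℝ[X]} (hc : c ≠ 0)
    (ha : a ≠ 0) (hl : l.eval a = 1) (hS : (laguerreS m α).eval a ≠ 0)
    (hP : (exceptionalFactor m n α).eval a ≠ 0)
    (hL : exceptionalLaguerreI m n α = C c * ((X - C a) * l) * exceptionalFactor m n α) :
    1 - (α + 1) / a + 2 * ((derivative (laguerreS m α)).eval a / (laguerreS m α).eval a)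
        - 2 * ((derivative (exceptionalFactor m n α)).eval a
          / (exceptionalFactor m n α).eval a)
      = 2 * (derivative l).eval a := by
  -- At `a` the right side vanishes, and the first two derivatives of the exceptional polynomial are
  -- `c P` and `2 c (l' P + P')`, since `l(a) = 1`.
  have h := congrArg (eval a) (exceptionalLaguerreI_ode m n α)
  rw [hL] at h
  simp only [derivative_mul, derivative_add, derivative_sub, derivative_C, derivative_X,
    derivative_zero, derivative_one, eval_mul, eval_add, eval_sub, eval_C, eval_X, eval_neg,
    eval_ofNat, eval_zero, eval_one, hl] at h
  field_simp
  refine mul_left_cancel₀ hc ?_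
  linear_combination -h

theorem theorem3 (m n : ℕ) (hm : 1 ≤ m) (α : ℝ) (hα : 1 < α) :
    ∃ x : Fin n → ℝ, StrictMono x ∧
      Set.range x = {t : ℝ | 0 < t ∧ (exceptionalLaguerreI m n α).IsRoot t} ∧
      IsStable (vWeight m n α) (Set.Ioi 0) x (grunwaldSystem x) ∧
      IsMostEconomical (vWeight m n α) (Set.Ioi 0) x (grunwaldSystem x) := by
  obtain ⟨s, p, x, hx, hs, hp, hx0, hps, hS, hP, hL⟩ :=
    exists_exceptional_roots m n (α := α) (by linarith)
  have hSpos : ∀ t, 0 < t → 0 < (laguerreS m α).eval t := by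
    intro t ht
    rw [hS, eval_mul, eval_C, eval_prod]
    refine mul_pos (by positivity) (Finset.prod_pos fun i _ => ?_)
    simpa using add_pos ht (hs i)
  have hPpos : ∀ t, 0 < t → 0 < (exceptionalFactor m n α).eval t := by
    intro t ht
    rw [hP, eval_mul, eval_C, eval_prod]
    refine mul_pos (by positivity) (Finset.prod_pos fun i _ => ?_)
    simpa using add_pos ht (hp i)
  have hc : (-1) ^ n / (n.factorial : ℝ) ≠ 0 := by positivity
  have hstable : IsStable (vWeight m n α) (Set.Ioi 0) x (grunwaldSystem x) := by
    refine isStable_grunwaldSystem (fun t ht => ?_)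
      (isExpMixture_inv_vWeight hα hs hp hps hS hP) hx.injective hx0 fun i => ?_
    · have := hSpos t ht
      have := hPpos t ht
      have := Real.rpow_pos_of_pos ht (α + 1)
      rw [vWeight]
      positivity
    · obtain ⟨d, hd, hprod⟩ := X_sub_C_mul_lagrange_basis hx.injective i
      -- The nodal polynomial is replaced by `(X - x i)` times the fundamental polynomial, its
      -- normalizing constant `d` being absorbed into `c`.
      rw [hprod, ← mul_assoc (C _) (C d), ← C_mul] at hL
      rw [← exceptionalLaguerreI_ode_at_root (mul_ne_zero hc hd) (hx0 i).ne'
        (by simp [lagrange_basis_eval hx.injective]) (hSpos _ (hx0 i)).ne'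
        (hPpos _ (hx0 i)).ne' hL]
      exact hasDerivAt_inv_vWeight m n α (hx0 i) (hSpos _ (hx0 i)).ne' (hPpos _ (hx0 i)).ne'
  refine ⟨x, hx, ?_, hstable, hstable.isMostEconomical_grunwaldSystem hx.injective⟩
  ext t
  rw [Set.mem_range, Set.mem_ofPred_eq, IsRoot, hL, eval_mul, eval_mul, eval_C, eval_prod]
  constructor
  · rintro ⟨i, rfl⟩
    exact ⟨hx0 i, by rw [Finset.prod_eq_zero (Finset.mem_univ i) (by simp)]; simp⟩
  · rintro ⟨ht, h⟩
    rcases mul_eq_zero.1 h with h | h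
    · obtain ⟨i, -, hi⟩ := Finset.prod_eq_zero_iff.1 ((mul_eq_zero.1 h).resolve_left hc)
      exact ⟨i, by simpa [sub_eq_zero, eq_comm] using hi⟩
    · exact absurd h (hPpos t ht).ne'
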